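/- Let $\mathcal P(\mathbb R)$ be the set of probability distributions on $\mathbb R$. For $\eta,H\in\mathcal P(\mathbb R)$ and $0<\varepsilon\le 1$ write $\eta\odot_\varepsilon H:=(1-\varepsilon)\eta+\varepsilon H$, and let $m(\eta)$ be the mean of $\eta$. Let $\mathcal L\subset\mathcal P(\mathbb R)$ be a class of distributions with finite means, $K\ge 1$, and for an instance $\mu=(\mu_1,\dots,\mu_K)\in\mathcal L^K$ let $m^*(\mu):=\max_b m(\mu_b)$; arm $a$ is suboptimal if $m(\mu_a)<m^*(\mu)$. In round $n=1,2,\dots$ a (possibly randomised) algorithm chooses an arm $A_n\in\{1,\dots,K\}$ on the basis of the past arms and observations, and then observes a sample that, given the past and $A_n$, has law $\mu_{A_n}\odot_\varepsilon H_{A_n,n}$, where ${\bf H}_n=(H_{1,n},\dots,H_{K,n})\in\mathcal P(\mathbb R)^K$ are arbitrary corruption distributions. Let $N_a(T)$ be the number of pulls of arm $a$ in the first $T$ rounds. Write $\mathbb E_{\mu\odot_\varepsilon{\bf H}_T}$ for the expectation under corruptions ${\bf H}_T=({\bf H}_1,\dots,{\bf H}_T)$, and $\mathbb E_{\mu\odot_\varepsilon{\bf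 H}}$ when ${\bf H}_n={\bf H}$ for all $n$. The algorithm is uniformly good (for $\mathcal L$ and $\varepsilon$) if for all $\mu\in\mathcal L^K$, all suboptimal arms $a$ of $\mu$ and all $\alpha>0$, $$\sup_{{\bf H}_T\in\mathcal P(\mathbb R)^{T\times K}}\mathbb E_{\mu\odot_\varepsilon{\bf H}_T}[N_a(T)]=o(T^\alpha)\qquad(T\to\infty).$$ For $\eta\in\mathcal P(\mathbb R)$ and $x\in\mathbb R$ let $$\mathrm{KL}^\varepsilon_{\inf}(\eta,x;\mathcal L):=\inf\{\mathrm{KL}(\eta\odot_\varepsilon H,\ \kappa\odot_\varepsilon H'):\ \kappa\in\mathcal L,\ m(\kappa)>x,\ H,H'\in\mathcal P(\mathbb R)\}\in[0,\infty],$$ with $\inf\emptyset=\infty$. **Theorem (Lower bound).** Let $0<\varepsilon\le 1$, $\mathcal L$ and $\mu\in\mathcal L^K$ be as above. For any uniformly good algorithm and any suboptimal arm $a$ of $\mu$, $$\liminf_{T\to\infty}\ \frac1{\log T}\ \sup_{{\bf H}\in\mathcal P(\mathbb R)^K}\mathbb E_{\mu\odot_\varepsilon{\bf H}}[N_a(T)]\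 \ge\ \frac1{\mathrm{KL}^\varepsilon_{\inf}(\mu_a,m^*(\mu);\mathcal L)},$$ where $1/0=\infty$ and $1/\infty=0$. -/

import Mathlib

open MeasureTheory ProbabilityTheory Filter Asymptotics
open scoped ENNReal Topology

namespace CorruptedBandit

/-- The mean `m(κ)` of a probability distribution on `ℝ`. -/
noncomputable def mean (κ : ProbabilityMeasure ℝ) : ℝ := ∫ x, x ∂(κ : Measure ℝ)

/-- The largest mean `m*(μ)` of the arms of a bandit instance `μ = (μ_1, …, μ_K)`. -/
noncomputable def maxMean {K : ℕ} (μ : Fin K → ProbabilityMeasure ℝ) : ℝ := ⨆ b, mean (μ b)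

/-- Arm `a` is suboptimal in the instance `μ`. -/
def IsSuboptimal {K : ℕ} (μ : Fin K → ProbabilityMeasure ℝ) (a : Fin K) : Prop :=
  mean (μ a) < maxMean μ

/-- The corrupted distribution `η ⊙_ε H = (1 - ε) η + ε H`. -/
noncomputable def corrupt (ε : ℝ) (η H : ProbabilityMeasure ℝ) : Measure ℝ :=
  ENNReal.ofReal (1 - ε) • (η : Measure ℝ) + ENNReal.ofReal ε • (H : Measure ℝ)

instance (ε : ℝ) (η H : ProbabilityMeasure ℝ) : IsFiniteMeasure (corrupt ε η H) := by
  have h1 := Measure.smul_finite (η : Measure ℝ) (c := ENNReal.ofReal (1 - ε)) ENNReal.ofReal_ne_top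
  have h2 := Measure.smul_finite (H : Measure ℝ) (c := ENNReal.ofReal ε) ENNReal.ofReal_ne_top
  unfold corrupt
  infer_instance

theorem isProbabilityMeasure_corrupt {ε : ℝ} (h0 : 0 ≤ ε) (h1 : ε ≤ 1)
    (η H : ProbabilityMeasure ℝ) : IsProbabilityMeasure (corrupt ε η H) := by
  constructor
  simp only [corrupt, Measure.coe_add, Measure.coe_smul, Pi.add_apply, Pi.smul_apply, smul_eq_mul,
    measure_univ, mul_one]
  rw [← ENNReal.ofReal_add (by linarith) h0]
  simp

/-- The corrupted KL-inf: the infimum of `KL(η ⊙_ε H, κ ⊙_ε H')` over all corruption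
distributions `H, H'` and all `κ ∈ L` whose mean exceeds `x` (it is `∞` if there is no such `κ`). -/
noncomputable def corruptedKLInf (ε : ℝ) (η : ProbabilityMeasure ℝ) (x : ℝ)
    (L : Set (ProbabilityMeasure ℝ)) : ℝ≥0∞ :=
  ⨅ (κ ∈ {κ ∈ L | x < mean κ}) (H : ProbabilityMeasure ℝ) (H' : ProbabilityMeasure ℝ),
    InformationTheory.klDiv (corrupt ε η H) (corrupt ε κ H')

/-- What the algorithm has seen before round `n` (rounds are numbered from `0`): the arms it pulled
and the (possibly corrupted) observations it received. -/
abbrev History (K n : ℕ) : Type := Fin n → Fin K × ℝ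

/-- A randomised bandit algorithm for `K` arms: in round `n` it draws an arm from a distribution
that depends measurably on the history. -/
structure Algorithm (K : ℕ) where
  select : (n : ℕ) → Kernel (History K n) (Fin K)
  isMarkovKernel_select : ∀ n, IsMarkovKernel (select n)

/-- The observation in a round with corruption distributions `H`, given the pulled arm: it has
law `μ_a ⊙_ε H_a`. -/
noncomputable def observe {K : ℕ} (ε : ℝ) (μ H : Fin K → ProbabilityMeasure ℝ) :
    Kernel (Fin K) ℝ :=
  Kernel.ofFunOfCountable fun a => corrupt ε (μ a) (H a)

instance {K : ℕ} (ε : ℝ) (μ H : Fin K → ProbabilityMeasure ℝ) :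
    IsFiniteKernel (observe ε μ H) := by
  refine ⟨⟨∑ a, observe ε μ H a Set.univ, ?_, fun a => ?_⟩⟩
  · refine ENNReal.sum_lt_top.2 fun a _ => ?_
    change corrupt ε (μ a) (H a) Set.univ < ∞
    exact measure_lt_top _ _
  · exact Finset.single_le_sum (f := fun a => observe ε μ H a Set.univ)
      (fun _ _ => zero_le) (Finset.mem_univ a)

/-- Appending the arm and the observation of round `n` to the history. -/
def extend {K n : ℕ} (p : History K n × (Fin K × ℝ)) : History K (n + 1) :=
  Fin.snoc (α := fun _ => Fin K × ℝ) p.1 p.2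

theorem measurable_extend {K n : ℕ} : Measurable (extend : _ → History K (n + 1)) := by
  refine measurable_pi_iff.2 fun i => ?_
  induction i using Fin.lastCases with
  | last => simpa [extend] using measurable_snd
  | cast j =>
    have h : Measurable fun p : History K n × (Fin K × ℝ) => p.1 j :=
      (measurable_pi_apply j).comp measurable_fst
    simpa [extend] using h

/-- The law of the history of the first `n` rounds when the algorithm `π` plays the instance `μ`
and the corruption distribution of arm `a` in round `t` is `H t a`. -/
noncomputable def historyLaw {K : ℕ} (ε : ℝ) (π : Algorithm K) (μ : Fin K → ProbabilityMeasure ℝ)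
    (H : ℕ → Fin K → ProbabilityMeasure ℝ) : (n : ℕ) → Measure (History K n)
  | 0 => Measure.dirac Fin.elim0
  | n + 1 =>
    (historyLaw ε π μ H n ⊗ₘ
      (π.select n ⊗ₖ Kernel.prodMkLeft (History K n) (observe ε μ (H n)))).map extend

/-- The number `N_a(T)` of pulls of arm `a` in the first `T` rounds. -/
def pulls {K T : ℕ} (a : Fin K) (h : History K T) : ℕ :=
  (Finset.univ.filter fun t => (h t).1 = a).card

/-- The expectation of `N_a(T)` under the corrupted bandit process; only the first `T` terms of
the sequence `H` of corruption vectors matter. -/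
noncomputable def expectedPulls {K : ℕ} (ε : ℝ) (π : Algorithm K)
    (μ : Fin K → ProbabilityMeasure ℝ) (H : ℕ → Fin K → ProbabilityMeasure ℝ) (a : Fin K) (T : ℕ) :
    ℝ≥0∞ :=
  ∫⁻ h, (pulls a h : ℝ≥0∞) ∂(historyLaw ε π μ H T)

/-- `π` is uniformly good on the class `L` for the corruption level `ε`: for every instance in
`L^K` and every suboptimal arm `a`, the supremum of `E[N_a(T)]` over all time-varying corruptions
is `o(T^α)` for every `α > 0`. -/
def UniformlyGood {K : ℕ} (ε : ℝ) (L : Set (ProbabilityMeasure ℝ)) (π : Algorithm K) : Prop :=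
  ∀ μ : Fin K → ProbabilityMeasure ℝ, (∀ b, μ b ∈ L) → ∀ a, IsSuboptimal μ a →
    ∀ α : ℝ, 0 < α →
      (fun T : ℕ => (⨆ H : ℕ → Fin K → ProbabilityMeasure ℝ,
        expectedPulls ε π μ H a T).toReal) =o[atTop] fun T : ℕ => (T : ℝ) ^ α

end CorruptedBandit

/-!
The proof is a change of measure. Fix `κ ∈ L` with mean above `maxMean μ` and corruptions `H` of
`μ a` and `H'` of `κ`, with divergence `d = KL(μ a ⊙ H, κ ⊙ H') < ∞`. Let `ν` be the instance `μ`
with arm `a` replaced by `κ`, and corrupt the other arms in the same way in both instances. Then the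
laws `P` and `Q` of the first `T` rounds under `μ` and `ν` satisfy `KL(P, Q) ≤ E_P[N_a(T)] d`
(`klDiv_historyLaw_le`), since a round reveals something only if it pulls `a`.

On the other hand `P` and `Q` are far apart on the event `s` that `a` is pulled in less than half of
the rounds: `a` is suboptimal in `μ`, so uniform goodness and Markov's inequality give `P s → 1`
(`eventually_le_prob_lt_half`), and `a` is the only optimal arm of `ν`, so `Q s ≤ T ^ (α - 1)` for
every `α > 0` and large `T` (`eventually_prob_lt_half_le`). Restricting the divergence to `s` yields
`KL(P, Q) ≥ P s * log (1 / Q s) - 1` (`mul_log_inv_sub_one_le_klDiv`), hence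
`c * log T ≤ E_P[N_a(T)] d` for every `c < 1` and large `T` (`eventually_mul_log_le`). In particular
`d ≠ 0`; dividing by `d`, letting `c → 1` and taking the infimum over `κ`, `H`, `H'` concludes.
-/

namespace CorruptedBandit

open InformationTheory

/-! ### Kullback-Leibler divergence -/

theorem klDiv_restrict_le {X : Type*} [MeasurableSpace X] (P Q : Measure X) [IsFiniteMeasure P]
    [IsFiniteMeasure Q] {s : Set X} (hs : MeasurableSet s) :
    klDiv (P.restrict s) (Q.restrict s) ≤ klDiv P Q := by
  by_cases hPQ : P ≪ Q
  swap; · simp [hPQ]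
  have hd : P.restrict s = (Q.restrict s).withDensity (P.rnDeriv Q) := by
    rw [← restrict_withDensity hs, Measure.withDensity_rnDeriv_eq _ _ hPQ]
  have hrn : (P.restrict s).rnDeriv (Q.restrict s) =ᵐ[Q.restrict s] P.rnDeriv Q := by
    rw [hd]
    exact Measure.rnDeriv_withDensity _ (Measure.measurable_rnDeriv _ _)
  rw [klDiv_eq_lintegral_klFun_of_ac (hPQ.restrict s), klDiv_eq_lintegral_klFun_of_ac hPQ]
  calc ∫⁻ x, ENNReal.ofReal (klFun ((P.restrict s).rnDeriv (Q.restrict s) x).toReal)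
        ∂(Q.restrict s)
      = ∫⁻ x in s, ENNReal.ofReal (klFun (P.rnDeriv Q x).toReal) ∂Q := by
        refine lintegral_congr_ae ?_
        filter_upwards [hrn] with x hx
        rw [hx]
    _ ≤ ∫⁻ x, ENNReal.ofReal (klFun (P.rnDeriv Q x).toReal) ∂Q := setLIntegral_le_lintegral _ _

/-- If an event has probability at most `r` under `Q`, then it can be likely under `P` only if the
divergence is of order `log r⁻¹`. -/
theorem mul_log_inv_sub_one_le_klDiv {X : Type*} [MeasurableSpace X] (P Q : Measure X)
    [IsFiniteMeasure P] [IsFiniteMeasure Q] {s : Set X} (hs : MeasurableSet s) {r : ℝ}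
    (hr : Q.real s ≤ r) :
    ENNReal.ofReal (P.real s * Real.log r⁻¹ - 1) ≤ klDiv P Q := by
  by_cases htop : klDiv P Q = ∞
  · simp [htop]
  have hac : P ≪ Q := (klDiv_ne_top_iff.1 htop).1
  rcases (measureReal_nonneg : 0 ≤ P.real s).eq_or_lt with hp | hp
  · rw [← hp]
    simp [ENNReal.ofReal_of_nonpos]
  -- absolute continuity excludes the junk value of `log (p / q)` at `q = 0`
  have hq : 0 < Q.real s := by
    refine measureReal_nonneg.lt_of_ne fun h => hp.ne' ?_
    rw [eq_comm, measureReal_eq_zero_iff] at h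
    rw [measureReal_eq_zero_iff]
    exact hac h
  have h1 := (mul_log_le_klDiv (P.restrict s) (Q.restrict s)).trans (klDiv_restrict_le P Q hs)
  refine le_trans (ENNReal.ofReal_le_ofReal ?_) h1
  simp only [measureReal_restrict_apply MeasurableSet.univ, Set.univ_inter]
  rw [Real.log_div hp.ne' hq.ne', Real.log_inv, mul_sub]
  have h2 : Real.log (Q.real s) ≤ Real.log r := Real.log_le_log hq hr
  have h3 := klFun_nonneg hp.le
  rw [klFun_apply] at h3
  have h4 := mul_le_mul_of_nonneg_left h2 hp.le
  linarith

/-- The conditional divergence of `klDiv_compProd_eq_add` in integral form. The density of `M ⊗ₘ κ`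
with respect to `M ⊗ₘ η` is the jointly measurable density of the kernels. -/
theorem klDiv_compProd_right {X Y : Type*} [MeasurableSpace X] [MeasurableSpace Y]
    [MeasurableSpace.CountableOrCountablyGenerated X Y] (M : Measure X) [IsFiniteMeasure M]
    (κ η : Kernel X Y) [IsFiniteKernel κ] [IsFiniteKernel η] (hac : ∀ x, κ x ≪ η x) :
    klDiv (M ⊗ₘ κ) (M ⊗ₘ η) = ∫⁻ x, klDiv (κ x) (η x) ∂M := by
  have hκ : η.withDensity (κ.rnDeriv η) = κ :=
    Kernel.ext fun x => Kernel.withDensity_rnDeriv_eq (hac x)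
  have : IsFiniteKernel (η.withDensity (κ.rnDeriv η)) := by rw [hκ]; infer_instance
  have hmeas : Measurable fun p : X × Y => κ.rnDeriv η p.1 p.2 := Kernel.measurable_rnDeriv κ η
  have hd : M ⊗ₘ κ = (M ⊗ₘ η).withDensity fun p => κ.rnDeriv η p.1 p.2 := by
    rw [← Measure.compProd_withDensity hmeas, hκ]
  have hMac : M ⊗ₘ κ ≪ M ⊗ₘ η := hd ▸ withDensity_absolutelyContinuous _ _
  have hrn : (M ⊗ₘ κ).rnDeriv (M ⊗ₘ η) =ᵐ[M ⊗ₘ η] fun p => κ.rnDeriv η p.1 p.2 := by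
    rw [hd]
    exact Measure.rnDeriv_withDensity _ hmeas
  calc klDiv (M ⊗ₘ κ) (M ⊗ₘ η)
      = ∫⁻ p, ENNReal.ofReal (klFun (κ.rnDeriv η p.1 p.2).toReal) ∂(M ⊗ₘ η) := by
        rw [klDiv_eq_lintegral_klFun_of_ac hMac]
        refine lintegral_congr_ae ?_
        filter_upwards [hrn] with p hp
        rw [hp]
    _ = ∫⁻ x, ∫⁻ y, ENNReal.ofReal (klFun (κ.rnDeriv η x y).toReal) ∂η x ∂M :=
        Measure.lintegral_compProd
          (f := fun p : X × Y => ENNReal.ofReal (klFun (κ.rnDeriv η p.1 p.2).toReal)) (by fun_prop)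
    _ = ∫⁻ x, klDiv (κ x) (η x) ∂M := by
        refine lintegral_congr fun x => ?_
        rw [klDiv_eq_lintegral_klFun_of_ac (hac x)]
        refine lintegral_congr_ae ?_
        filter_upwards [Kernel.rnDeriv_eq_rnDeriv_measure (κ := κ) (η := η) (a := x)] with y hy
        rw [hy]

/-! ### The law of the history -/

instance {K : ℕ} (π : Algorithm K) (n : ℕ) : IsMarkovKernel (π.select n) :=
  π.isMarkovKernel_select n

theorem isMarkovKernel_observe {K : ℕ} {ε : ℝ} (h0 : 0 ≤ ε) (h1 : ε ≤ 1)
    (μ H : Fin K → ProbabilityMeasure ℝ) : IsMarkovKernel (observe ε μ H) :=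
  ⟨fun _ => isProbabilityMeasure_corrupt h0 h1 _ _⟩

/-- The joint law of the history before round `n` and of the arm pulled in round `n`. -/
noncomputable def armLaw {K : ℕ} (ε : ℝ) (π : Algorithm K) (μ : Fin K → ProbabilityMeasure ℝ)
    (H : ℕ → Fin K → ProbabilityMeasure ℝ) (n : ℕ) : Measure (History K n × Fin K) :=
  historyLaw ε π μ H n ⊗ₘ π.select n

theorem isProbabilityMeasure_historyLaw {K : ℕ} {ε : ℝ} (h0 : 0 ≤ ε) (h1 : ε ≤ 1)
    (π : Algorithm K) (μ : Fin K → ProbabilityMeasure ℝ) (H : ℕ → Fin K → ProbabilityMeasure ℝ)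
    (n : ℕ) : IsProbabilityMeasure (historyLaw ε π μ H n) := by
  induction n with
  | zero => rw [historyLaw]; infer_instance
  | succ n ih =>
    have := isMarkovKernel_observe h0 h1 μ (H n)
    rw [historyLaw]
    exact Measure.isProbabilityMeasure_map measurable_extend.aemeasurable

theorem isProbabilityMeasure_armLaw {K : ℕ} {ε : ℝ} (h0 : 0 ≤ ε) (h1 : ε ≤ 1)
    (π : Algorithm K) (μ : Fin K → ProbabilityMeasure ℝ) (H : ℕ → Fin K → ProbabilityMeasure ℝ)
    (n : ℕ) : IsProbabilityMeasure (armLaw ε π μ H n) := by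
  have := isProbabilityMeasure_historyLaw h0 h1 π μ H n
  rw [armLaw]
  infer_instance

/-! ### Counting pulls -/

theorem pulls_eq_sum {K T : ℕ} (a : Fin K) (h : History K T) :
    pulls a h = ∑ t, if (h t).1 = a then 1 else 0 :=
  Finset.card_filter _ _

theorem pulls_extend {K n : ℕ} (a : Fin K) (p : History K n × (Fin K × ℝ)) :
    pulls a (extend p) = pulls a p.1 + if p.2.1 = a then 1 else 0 := by
  rw [pulls_eq_sum, pulls_eq_sum, Fin.sum_univ_castSucc]
  simp only [extend, Fin.snoc_castSucc, Fin.snoc_last]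

theorem measurable_pulls {K T : ℕ} (a : Fin K) : Measurable (pulls (T := T) a) := by
  rw [funext (pulls_eq_sum (T := T) a)]
  refine Finset.measurable_fun_sum _ fun t _ => ?_
  exact Measurable.ite ((measurable_fst.comp (measurable_pi_apply t)) (measurableSet_singleton a))
    measurable_const measurable_const

theorem measurable_pulls_cast {K T : ℕ} (a : Fin K) :
    Measurable fun h : History K T => (pulls a h : ℝ≥0∞) :=
  measurable_from_nat.comp (measurable_pulls a)

theorem sum_pulls {K T : ℕ} (h : History K T) : ∑ b, pulls b h = T := by
  simp only [pulls]
  rw [← Finset.card_eq_sum_card_fiberwise (f := fun t => (h t).1) (fun _ _ => Finset.mem_univ _)]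
  simp

theorem pulls_le {K T : ℕ} (a : Fin K) (h : History K T) : pulls a h ≤ T :=
  (Finset.card_filter_le _ _).trans (by simp)

theorem expectedPulls_le {K : ℕ} {ε : ℝ} (h0 : 0 ≤ ε) (h1 : ε ≤ 1) (π : Algorithm K)
    (μ : Fin K → ProbabilityMeasure ℝ) (H : ℕ → Fin K → ProbabilityMeasure ℝ) (a : Fin K) (T : ℕ) :
    expectedPulls ε π μ H a T ≤ T := by
  have := isProbabilityMeasure_historyLaw h0 h1 π μ H T
  calc expectedPulls ε π μ H a T
      ≤ ∫⁻ _, (T : ℝ≥0∞) ∂(historyLaw ε π μ H T) :=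
        lintegral_mono fun h => Nat.cast_le.2 (pulls_le a h)
    _ = T := by simp

theorem expectedPulls_succ {K : ℕ} {ε : ℝ} (h0 : 0 ≤ ε) (h1 : ε ≤ 1) (π : Algorithm K)
    (μ : Fin K → ProbabilityMeasure ℝ) (H : ℕ → Fin K → ProbabilityMeasure ℝ) (a : Fin K) (n : ℕ) :
    expectedPulls ε π μ H a (n + 1) =
      expectedPulls ε π μ H a n + armLaw ε π μ H n {p | p.2 = a} := by
  have := isProbabilityMeasure_historyLaw h0 h1 π μ H n
  have := isMarkovKernel_observe h0 h1 μ (H n)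
  have hms : MeasurableSet {p : History K n × Fin K | p.2 = a} :=
    measurable_snd (measurableSet_singleton a)
  rw [expectedPulls, historyLaw, lintegral_map (measurable_pulls_cast a) measurable_extend,
    ← Measure.compProd_assoc', lintegral_map (f := fun p => (pulls a (extend p) : ℝ≥0∞))
      ((measurable_pulls_cast a).comp measurable_extend) (MeasurableEquiv.measurable _)]
  have hpt : ∀ p : (History K n × Fin K) × ℝ,
      (pulls a (extend (MeasurableEquiv.prodAssoc p)) : ℝ≥0∞) =
        pulls a p.1.1 + {p : History K n × Fin K | p.2 = a}.indicator 1 p.1 := by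
    rintro ⟨⟨h, b⟩, y⟩
    rw [pulls_extend]
    by_cases hb : b = a <;> simp [MeasurableEquiv.prodAssoc, hb]
  simp_rw [hpt]
  have hm1 : Measurable fun p : History K n × Fin K => (pulls a p.1 : ℝ≥0∞) :=
    (measurable_pulls_cast a).comp measurable_fst
  have hm2 : Measurable ({p : History K n × Fin K | p.2 = a}.indicator
      (1 : History K n × Fin K → ℝ≥0∞)) :=
    measurable_one.indicator hms
  have hm3 : Measurable fun p : (History K n × Fin K) × ℝ =>
      (pulls a p.1.1 : ℝ≥0∞) + {p : History K n × Fin K | p.2 = a}.indicator 1 p.1 :=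
    (hm1.add hm2).comp measurable_fst
  rw [Measure.lintegral_compProd hm3]
  simp only [lintegral_const, measure_univ, mul_one]
  rw [lintegral_add_left hm1, lintegral_indicator_one hms, Measure.lintegral_compProd hm1]
  simp [expectedPulls, armLaw]

/-! ### Divergence decomposition -/

/-- Two instances, with their corruptions, that differ only in arm `a`: the histories of the first
`T` rounds have divergence at most that of the observations of arm `a`, times the expected number of
pulls of `a`. -/
theorem klDiv_historyLaw_le {K : ℕ} {ε : ℝ} (h0 : 0 ≤ ε) (h1 : ε ≤ 1) (π : Algorithm K)
    (μ ν H H' : Fin K → ProbabilityMeasure ℝ) (a : Fin K)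
    (hne : ∀ b ≠ a, corrupt ε (μ b) (H b) = corrupt ε (ν b) (H' b))
    (hac : corrupt ε (μ a) (H a) ≪ corrupt ε (ν a) (H' a)) (T : ℕ) :
    klDiv (historyLaw ε π μ (fun _ => H) T) (historyLaw ε π ν (fun _ => H') T) ≤
      expectedPulls ε π μ (fun _ => H) a T *
        klDiv (corrupt ε (μ a) (H a)) (corrupt ε (ν a) (H' a)) := by
  induction T with
  | zero => simp [historyLaw]
  | succ n ih =>
    have := isProbabilityMeasure_historyLaw h0 h1 π μ (fun _ => H) n
    have := isProbabilityMeasure_historyLaw h0 h1 π ν (fun _ => H') n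
    have := isProbabilityMeasure_armLaw h0 h1 π μ (fun _ => H) n
    have := isProbabilityMeasure_armLaw h0 h1 π ν (fun _ => H') n
    have := isMarkovKernel_observe h0 h1 μ H
    have := isMarkovKernel_observe h0 h1 ν H'
    have hac' : ∀ b, corrupt ε (μ b) (H b) ≪ corrupt ε (ν b) (H' b) := fun b => by
      by_cases hb : b = a
      · exact hb ▸ hac
      · rw [hne b hb]
    have hms : MeasurableSet {p : History K n × Fin K | p.2 = a} :=
      measurable_snd (measurableSet_singleton a)
    have hround : klDiv
        (armLaw ε π μ (fun _ => H) n ⊗ₘ Kernel.prodMkLeft (History K n) (observe ε μ H))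
        (armLaw ε π μ (fun _ => H) n ⊗ₘ Kernel.prodMkLeft (History K n) (observe ε ν H')) =
        armLaw ε π μ (fun _ => H) n {p | p.2 = a} *
          klDiv (corrupt ε (μ a) (H a)) (corrupt ε (ν a) (H' a)) := by
      rw [klDiv_compProd_right _ _ _ fun p => hac' p.2, mul_comm, ← lintegral_indicator_const hms]
      refine lintegral_congr fun p => ?_
      change klDiv (corrupt ε (μ p.2) (H p.2)) (corrupt ε (ν p.2) (H' p.2)) = _
      by_cases hp : p.2 = a
      · simp [hp]
      · simp [hp, hne p.2 hp]
    rw [expectedPulls_succ h0 h1, add_mul, historyLaw, historyLaw]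
    refine (klDiv_map_le _ _ measurable_extend).trans ?_
    rw [← Measure.compProd_assoc', ← Measure.compProd_assoc']
    refine (klDiv_map_le _ _ (MeasurableEquiv.measurable _)).trans ?_
    rw [klDiv_compProd_eq_add, klDiv_compProd_left]
    exact add_le_add ih hround.le

/-! ### Typical and atypical numbers of pulls -/

/-- Markov's inequality for the event that `a` is pulled in at least half of the rounds. -/
theorem mul_prob_half_le {K : ℕ} {ε : ℝ} (h0 : 0 ≤ ε) (h1 : ε ≤ 1) (π : Algorithm K)
    (μ : Fin K → ProbabilityMeasure ℝ) (H : ℕ → Fin K → ProbabilityMeasure ℝ) (a : Fin K) (T : ℕ) :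
    T * (historyLaw ε π μ H T).real {h | T ≤ 2 * pulls a h} ≤
      2 * (expectedPulls ε π μ H a T).toReal := by
  have := isProbabilityMeasure_historyLaw h0 h1 π μ H T
  have hm := mul_meas_ge_le_lintegral (μ := historyLaw ε π μ H T)
    ((measurable_pulls_cast (T := T) a).const_mul 2) (T : ℝ≥0∞)
  rw [lintegral_const_mul _ (measurable_pulls_cast a)] at hm
  have hset : {h : History K T | (T : ℝ≥0∞) ≤ 2 * (pulls a h : ℝ≥0∞)} =
      {h | T ≤ 2 * pulls a h} := by
    ext h
    exact_mod_cast Iff.rfl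
  rw [hset] at hm
  have hfin : expectedPulls ε π μ H a T ≠ ∞ :=
    ne_top_of_le_ne_top (ENNReal.natCast_ne_top T) (expectedPulls_le h0 h1 π μ H a T)
  simpa [Measure.real] using ENNReal.toReal_mono (ENNReal.mul_ne_top (by simp) hfin) hm

/-- Markov's inequality for the event that `a` is pulled in less than half of the rounds, through
the pulls of the other arms. -/
theorem mul_prob_lt_half_le {K : ℕ} {ε : ℝ} (h0 : 0 ≤ ε) (h1 : ε ≤ 1) (π : Algorithm K)
    (μ : Fin K → ProbabilityMeasure ℝ) (H : ℕ → Fin K → ProbabilityMeasure ℝ) (a : Fin K) (T : ℕ) :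
    T * (historyLaw ε π μ H T).real {h | 2 * pulls a h < T} ≤
      2 * ∑ b ∈ Finset.univ.erase a, (expectedPulls ε π μ H b T).toReal := by
  have := isProbabilityMeasure_historyLaw h0 h1 π μ H T
  have hmeas : Measurable fun h : History K T =>
      ∑ b ∈ Finset.univ.erase a, (pulls b h : ℝ≥0∞) :=
    Finset.measurable_fun_sum _ fun b _ => measurable_pulls_cast b
  have hm := mul_meas_ge_le_lintegral (μ := historyLaw ε π μ H T)
    (hmeas.const_mul 2) (T : ℝ≥0∞)
  rw [lintegral_const_mul _ hmeas,
    lintegral_finsetSum _ fun b _ => measurable_pulls_cast b] at hm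
  have hsub : {h : History K T | 2 * pulls a h < T} ⊆
      {h | (T : ℝ≥0∞) ≤ 2 * ∑ b ∈ Finset.univ.erase a, (pulls b h : ℝ≥0∞)} := by
    intro h hh
    have hs := Finset.add_sum_erase Finset.univ (fun b => pulls b h) (Finset.mem_univ a)
    rw [sum_pulls] at hs
    simp only [Set.mem_ofPred_eq] at hh ⊢
    have : T ≤ 2 * ∑ b ∈ Finset.univ.erase a, pulls b h := by omega
    exact_mod_cast this
  have hfin : ∀ b, expectedPulls ε π μ H b T ≠ ∞ := fun b =>
    ne_top_of_le_ne_top (ENNReal.natCast_ne_top T) (expectedPulls_le h0 h1 π μ H b T)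
  have hle := (mul_le_mul_right (measure_mono hsub) (T : ℝ≥0∞)).trans hm
  have hreal := ENNReal.toReal_mono
    (ENNReal.mul_ne_top (by simp) (ENNReal.sum_ne_top.2 fun b _ => hfin b)) hle
  rw [ENNReal.toReal_mul, ENNReal.toReal_mul, ENNReal.toReal_sum fun b _ => hfin b] at hreal
  simpa [Measure.real, expectedPulls] using hreal

/-- The worst-case expected numbers of pulls are finite, so that `toReal` in `UniformlyGood` is
faithful. -/
theorem toReal_expectedPulls_le_iSup {K : ℕ} {ε : ℝ} (h0 : 0 ≤ ε) (h1 : ε ≤ 1) (π : Algorithm K)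
    (μ : Fin K → ProbabilityMeasure ℝ) (H : ℕ → Fin K → ProbabilityMeasure ℝ) (a : Fin K) (T : ℕ) :
    (expectedPulls ε π μ H a T).toReal ≤
      (⨆ H : ℕ → Fin K → ProbabilityMeasure ℝ, expectedPulls ε π μ H a T).toReal :=
  ENNReal.toReal_mono
    (ne_top_of_le_ne_top (ENNReal.natCast_ne_top T)
      (iSup_le fun H => expectedPulls_le h0 h1 π μ H a T))
    (le_iSup (fun H : ℕ → Fin K → ProbabilityMeasure ℝ => expectedPulls ε π μ H a T) H)

/-- Under a uniformly good algorithm, a suboptimal arm is rarely pulled in half of the rounds. -/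
theorem eventually_le_prob_lt_half {K : ℕ} {ε : ℝ} (h0 : 0 ≤ ε) (h1 : ε ≤ 1)
    {L : Set (ProbabilityMeasure ℝ)} {π : Algorithm K} (hπ : UniformlyGood ε L π)
    {μ : Fin K → ProbabilityMeasure ℝ} (hμ : ∀ b, μ b ∈ L) {a : Fin K} (ha : IsSuboptimal μ a)
    (H : ℕ → Fin K → ProbabilityMeasure ℝ) {δ : ℝ} (hδ : 0 < δ) :
    ∀ᶠ T : ℕ in atTop, 1 - δ ≤ (historyLaw ε π μ H T).real {h | 2 * pulls a h < T} := by
  filter_upwards [(hπ μ hμ a ha 1 one_pos).def (half_pos hδ), eventually_gt_atTop 0] with T hT hT0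
  have := isProbabilityMeasure_historyLaw h0 h1 π μ H T
  have hms : MeasurableSet {h : History K T | 2 * pulls a h < T} :=
    measurable_pulls a (MeasurableSet.of_discrete (s := {k | 2 * k < T}))
  have hc := probReal_compl_eq_one_sub (μ := historyLaw ε π μ H T) hms
  have hset : {h : History K T | 2 * pulls a h < T}ᶜ = {h | T ≤ 2 * pulls a h} := by
    ext h
    simp
  rw [hset] at hc
  have hTr : (0 : ℝ) < T := Nat.cast_pos.2 hT0
  rw [Real.rpow_one, Real.norm_of_nonneg ENNReal.toReal_nonneg, Real.norm_of_nonneg hTr.le] at hT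
  have hm := mul_prob_half_le h0 h1 π μ H a T
  have hs := toReal_expectedPulls_le_iSup h0 h1 π μ H a T
  have : T * (historyLaw ε π μ H T).real {h | T ≤ 2 * pulls a h} ≤ T * δ := by linarith
  have := le_of_mul_le_mul_left this hTr
  linarith

/-- Under a uniformly good algorithm, an arm that is the unique optimal one is pulled in less than
half of the rounds only with a polynomially small probability. -/
theorem eventually_prob_lt_half_le {K : ℕ} {ε : ℝ} (h0 : 0 ≤ ε) (h1 : ε ≤ 1)
    {L : Set (ProbabilityMeasure ℝ)} {π : Algorithm K} (hπ : UniformlyGood ε L π)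
    {ν : Fin K → ProbabilityMeasure ℝ} (hν : ∀ b, ν b ∈ L) {a : Fin K}
    (ha : ∀ b ≠ a, IsSuboptimal ν b) (H : ℕ → Fin K → ProbabilityMeasure ℝ) {α : ℝ} (hα : 0 < α) :
    ∀ᶠ T : ℕ in atTop,
      (historyLaw ε π ν H T).real {h | 2 * pulls a h < T} ≤ (T : ℝ) ^ (α - 1) := by
  have hsum : (fun T : ℕ => ∑ b ∈ Finset.univ.erase a,
      (⨆ H : ℕ → Fin K → ProbabilityMeasure ℝ, expectedPulls ε π ν H b T).toReal) =o[atTop]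
      fun T : ℕ => (T : ℝ) ^ α :=
    IsLittleO.fun_sum fun b hb => hπ ν hν b (ha b (Finset.ne_of_mem_erase hb)) α hα
  filter_upwards [hsum.def (half_pos one_pos), eventually_gt_atTop 0] with T hT hT0
  have hTr : (0 : ℝ) < T := Nat.cast_pos.2 hT0
  rw [Real.norm_of_nonneg (Finset.sum_nonneg fun _ _ => ENNReal.toReal_nonneg),
    Real.norm_of_nonneg (by positivity)] at hT
  have hm := mul_prob_lt_half_le h0 h1 π ν H a T
  have hs := Finset.sum_le_sum fun b (_ : b ∈ Finset.univ.erase a) =>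
    toReal_expectedPulls_le_iSup h0 h1 π ν H b T
  have hpow : (T : ℝ) * (T : ℝ) ^ (α - 1) = (T : ℝ) ^ α := by
    rw [Real.rpow_sub_one hTr.ne']
    field_simp
  refine le_of_mul_le_mul_left (a := (T : ℝ)) ?_ hTr
  rw [hpow]
  linarith

/-! ### The lower bound -/

theorem isSuboptimal_update {K : ℕ} {μ : Fin K → ProbabilityMeasure ℝ} {κ : ProbabilityMeasure ℝ}
    (hκ : maxMean μ < mean κ) {a b : Fin K} (hb : b ≠ a) :
    IsSuboptimal (Function.update μ a κ) b := by
  have hle : mean (μ b) ≤ maxMean μ :=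
    le_ciSup (f := fun b => mean (μ b)) (Set.finite_range _).bddAbove b
  have hge : mean κ ≤ maxMean (Function.update μ a κ) := by
    simpa [maxMean] using
      le_ciSup (f := fun c => mean (Function.update μ a κ c)) (Set.finite_range _).bddAbove a
  rw [IsSuboptimal, Function.update_of_ne hb]
  linarith

/-- The lower bound for a fixed confusing alternative `κ` and fixed corruptions of `μ a` and `κ`, up
to a factor `c < 1`. -/
theorem eventually_mul_log_le {K : ℕ} {ε : ℝ} (h0 : 0 ≤ ε) (h1 : ε ≤ 1)
    {L : Set (ProbabilityMeasure ℝ)} {π : Algorithm K} (hπ : UniformlyGood ε L π)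
    {μ : Fin K → ProbabilityMeasure ℝ} (hμ : ∀ b, μ b ∈ L) {a : Fin K} (ha : IsSuboptimal μ a)
    {κ : ProbabilityMeasure ℝ} (hκL : κ ∈ L) (hκ : maxMean μ < mean κ)
    (H H' : ProbabilityMeasure ℝ) (hac : corrupt ε (μ a) H ≪ corrupt ε κ H')
    {c : ℝ} (hc0 : 0 < c) (hc : c < 1) :
    ∀ᶠ T : ℕ in atTop, ENNReal.ofReal (c * Real.log T) ≤
      (⨆ H : Fin K → ProbabilityMeasure ℝ, expectedPulls ε π μ (fun _ => H) a T) *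
        klDiv (corrupt ε (μ a) H) (corrupt ε κ H') := by
  set ν := Function.update μ a κ
  set Hμ : Fin K → ProbabilityMeasure ℝ := fun _ => H
  set Hν : Fin K → ProbabilityMeasure ℝ := Function.update Hμ a H'
  have hνL : ∀ b, ν b ∈ L := fun b => by
    by_cases hb : b = a
    · subst hb
      simpa [ν] using hκL
    · simpa [ν, hb] using hμ b
  -- chosen so that `(1 - α) ^ 2 ≥ (1 + c) / 2`, which leaves room for the additive constant
  set α := (1 - c) / 4 with hα
  have hα0 : 0 < α := by linarith
  have hα1 : α < 1 := by linarith
  have hlog : ∀ᶠ T : ℕ in atTop, 2 / (1 - c) ≤ Real.log T :=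
    (Real.tendsto_log_atTop.comp tendsto_natCast_atTop_atTop).eventually_ge_atTop _
  filter_upwards [eventually_le_prob_lt_half h0 h1 hπ hμ ha (fun _ => Hμ) hα0,
    eventually_prob_lt_half_le h0 h1 hπ hνL (a := a) (fun b hb => isSuboptimal_update hκ hb)
      (fun _ => Hν) hα0, hlog, eventually_gt_atTop 0] with T hP hQ hT hT0
  have := isProbabilityMeasure_historyLaw h0 h1 π μ (fun _ => Hμ) T
  have := isProbabilityMeasure_historyLaw h0 h1 π ν (fun _ => Hν) T
  have hms : MeasurableSet {h : History K T | 2 * pulls a h < T} :=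
    measurable_pulls a (MeasurableSet.of_discrete (s := {k | 2 * k < T}))
  have hlow := mul_log_inv_sub_one_le_klDiv (historyLaw ε π μ (fun _ => Hμ) T)
    (historyLaw ε π ν (fun _ => Hν) T) hms hQ
  have hup := klDiv_historyLaw_le h0 h1 π μ ν Hμ Hν a
    (fun b hb => by simp [ν, Hν, hb]) (by simpa [ν, Hν, Hμ] using hac) T
  have hκa : corrupt ε (ν a) (Hν a) = corrupt ε κ H' := by simp [ν, Hν]
  rw [hκa] at hup
  have hsup := le_iSup (fun H : Fin K → ProbabilityMeasure ℝ =>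
    expectedPulls ε π μ (fun _ => H) a T) Hμ
  refine le_trans (ENNReal.ofReal_le_ofReal ?_) ((hlow.trans hup).trans (mul_le_mul_left hsup _))
  have hT1 : 1 ≤ Real.log T * ((1 - c) / 2) := by
    rw [div_le_iff₀ (by linarith)] at hT
    linarith
  have hlog0 : 0 ≤ Real.log T := Real.log_natCast_nonneg T
  rw [← Real.rpow_neg (Nat.cast_nonneg T), Real.log_rpow (Nat.cast_pos.2 hT0), neg_sub]
  have h2 : (1 - α) * ((1 - α) * Real.log T) ≤
      (historyLaw ε π μ (fun _ => Hμ) T).real {h | 2 * pulls a h < T} *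
        ((1 - α) * Real.log T) :=
    mul_le_mul_of_nonneg_right hP (mul_nonneg (by linarith) hlog0)
  have h3 : (1 + c) / 2 * Real.log T ≤ (1 - α) * ((1 - α) * Real.log T) := by
    rw [← mul_assoc]
    exact mul_le_mul_of_nonneg_right (by nlinarith [sq_nonneg α]) hlog0
  linarith

end CorruptedBandit

theorem theorem1 {K : ℕ} (ε : ℝ) (hε : 0 < ε) (hε1 : ε ≤ 1)
    (L : Set (ProbabilityMeasure ℝ))
    (hL : ∀ κ ∈ L, Integrable (fun x : ℝ => x) (κ : Measure ℝ))
    (μ : Fin K → ProbabilityMeasure ℝ) (hμ : ∀ b, μ b ∈ L)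
    (π : CorruptedBandit.Algorithm K) (hπ : CorruptedBandit.UniformlyGood ε L π)
    (a : Fin K) (ha : CorruptedBandit.IsSuboptimal μ a) :
    1 / CorruptedBandit.corruptedKLInf ε (μ a) (CorruptedBandit.maxMean μ) L ≤
      liminf (fun T : ℕ =>
        (⨆ H : Fin K → ProbabilityMeasure ℝ,
          CorruptedBandit.expectedPulls ε π μ (fun _ => H) a T) /
            ENNReal.ofReal (Real.log T)) atTop := by
  rw [one_div, ENNReal.inv_le_iff_inv_le, CorruptedBandit.corruptedKLInf]
  refine le_iInf₂ fun κ hκ => le_iInf₂ fun H H' => ?_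
  rw [ENNReal.inv_le_iff_inv_le]
  set d := InformationTheory.klDiv (CorruptedBandit.corrupt ε (μ a) H)
    (CorruptedBandit.corrupt ε κ H') with hd
  by_cases htop : d = ∞
  · simp [htop]
  have hev := fun {c : ℝ} (hc0 : 0 < c) (hc : c < 1) =>
    CorruptedBandit.eventually_mul_log_le hε.le hε1 hπ hμ ha hκ.1 hκ.2 H H'
      (InformationTheory.klDiv_ne_top_iff.1 htop).1 hc0 hc
  have hlog : ∀ᶠ T : ℕ in atTop, 0 < Real.log T :=
    (Real.tendsto_log_atTop.comp tendsto_natCast_atTop_atTop).eventually_gt_atTop 0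
  -- two instances that corruption makes indistinguishable admit no uniformly good algorithm
  have hd0 : d ≠ 0 := fun h => by
    obtain ⟨T, hT, hT'⟩ := ((hev (c := 1 / 2) (by norm_num) (by norm_num)).and hlog).exists
    rw [← hd, h, mul_zero, nonpos_iff_eq_zero, ENNReal.ofReal_eq_zero] at hT
    linarith
  refine le_of_forall_lt_imp_le_of_dense fun x hx => ?_
  have hxtop : x ≠ ∞ := hx.ne_top
  have hxd : x * d < 1 := by
    rwa [← one_div, ENNReal.lt_div_iff_mul_lt (Or.inl hd0) (Or.inl htop)] at hx
  refine le_liminf_of_le (by isBoundedDefault) ?_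
  rcases eq_or_ne x 0 with rfl | hx0
  · simp
  have hc0 : 0 < (x * d).toReal :=
    ENNReal.toReal_pos (mul_ne_zero hx0 hd0) (ENNReal.mul_ne_top hxtop htop)
  have hc1 : (x * d).toReal < 1 := by
    simpa using (ENNReal.toReal_lt_toReal (ENNReal.mul_ne_top hxtop htop) ENNReal.one_ne_top).2 hxd
  filter_upwards [hev hc0 hc1, hlog] with T hT hT'
  rw [ENNReal.ofReal_mul hc0.le, ENNReal.ofReal_toReal (ENNReal.mul_ne_top hxtop htop),
    ← hd, mul_right_comm] at hT
  rw [ENNReal.le_div_iff_mul_le (Or.inl (by simpa using hT')) (Or.inl ENNReal.ofReal_ne_top)]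
  exact (ENNReal.mul_le_mul_iff_left hd0 htop).1 hT
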